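/- **Theorem 4.7.** Let $G$ be a finite simple graph that is a cactus graph, that is, $G$ is connected and every edge of $G$ lies on at most one cycle of $G$. Let $\mathbb F$ be $\mathbb R$ or $\mathbb C$. For a finite simple graph $H$ with vertex set $V$, let $\operatorname{msr}(H)$ denote the smallest rank of a positive semidefinite matrix $A=(a_{ij})_{i,j\in V}$ (real symmetric if $\mathbb F=\mathbb R$, complex Hermitian if $\mathbb F=\mathbb C$) such that, for all $i\neq j$, $a_{ij}\neq 0$ if and only if $i$ and $j$ are adjacent in $H$; the diagonal entries of $A$ are not constrained by $H$. Then $$\operatorname{msr}(G)+\operatorname{msr}(\overline G)\le |G|+2,$$ where $\overline G$ is the complement of $G$ and $|G|$ is the number of vertices of $G$. In other words, every cactus graph satisfies the positive semidefinite Graph Complement Conjecture over both $\mathbb R$ and $\mathbb C$. -/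

import Mathlib

open scoped ComplexOrder

namespace SimpleGraph

/-- A cactus graph: a connected simple graph in which every edge lies on at most one cycle.
A cycle is regarded as a subgraph, so two closed walks that run through the same cycle from
different starting points, or in different directions, count as the same cycle. -/
def IsCactus {V : Type*} (G : SimpleGraph V) : Prop :=
  G.Connected ∧
    ∀ ⦃e : Sym2 V⦄ ⦃u v : V⦄ (p : G.Walk u u) (q : G.Walk v v),
      p.IsCycle → q.IsCycle → e ∈ p.edges → e ∈ q.edges → p.toSubgraph = q.toSubgraph

/-- The positive semidefinite (in particular Hermitian) matrices over `𝕜`, which is `ℝ` or `ℂ`,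
whose graph is `G`: an off-diagonal entry is nonzero exactly when the two indices are adjacent.
Diagonal entries play no role in the graph of a matrix. -/
def psdMatrices (𝕜 : Type*) [RCLike 𝕜] {V : Type*} (G : SimpleGraph V) : Set (Matrix V V 𝕜) :=
  {A | A.PosSemidef ∧ ∀ i j : V, i ≠ j → (A i j ≠ 0 ↔ G.Adj i j)}

/-- The minimum semidefinite rank of `G` over `𝕜`: the smallest rank of a positive semidefinite
matrix whose graph is `G`. -/
noncomputable def msr (𝕜 : Type*) [RCLike 𝕜] {V : Type*} [Fintype V] (G : SimpleGraph V) : ℕ :=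
  sInf {r : ℕ | ∃ A ∈ G.psdMatrices 𝕜, A.rank = r}

/-- Some positive semidefinite matrix has graph `G`, so the minimum in `msr` is over a nonempty
set. -/
theorem psdMatrices_nonempty (𝕜 : Type*) [RCLike 𝕜] {V : Type*} [Fintype V]
    (G : SimpleGraph V) : (G.psdMatrices 𝕜).Nonempty := by
  classical
  have hN : (G.incMatrix 𝕜).conjTranspose = (G.incMatrix 𝕜).transpose := by
    ext e i
    by_cases h : e ∈ G.incidenceSet i <;> simp [Matrix.conjTranspose_apply, incMatrix_apply', h]
  refine ⟨G.incMatrix 𝕜 * (G.incMatrix 𝕜).transpose, ?_, fun i j hij => ?_⟩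
  · rw [← hN]
    exact Matrix.posSemidef_self_mul_conjTranspose _
  · by_cases h : G.Adj i j
    · simp [incMatrix_mul_transpose_apply_of_adj G h, h]
    · simp [Matrix.mul_apply,
        incMatrix_apply_mul_incMatrix_apply_of_not_adj G hij h, h]

/-- The minimum semidefinite rank is attained. -/
theorem exists_rank_eq_msr (𝕜 : Type*) [RCLike 𝕜] {V : Type*} [Fintype V]
    (G : SimpleGraph V) : ∃ A ∈ G.psdMatrices 𝕜, A.rank = G.msr 𝕜 :=
  Nat.sInf_mem (s := {r : ℕ | ∃ A ∈ G.psdMatrices 𝕜, A.rank = r})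
    (let ⟨A, hA⟩ := G.psdMatrices_nonempty 𝕜; ⟨A.rank, A, hA, rfl⟩)

end SimpleGraph

/-! With `n` the order of `G`, the bound is `(n - 1) + 3` for a tree and `(n - 2) + 4` otherwise.

For `G`, signed edge-weighted Laplacians are used. Constants always lie in the kernel, which gives
`n - 1`. If there is a cycle, one of its edges gets weight `-1` and its others a weight just large
enough for Cauchy-Schwarz to keep the form nonnegative. A function climbing by unit steps around the
cycle attains equality and gives a second kernel vector (`IsCactus.msr_add_two_le_card`).

For the complement, vectors are chosen one vertex at a time along a growing connected set `S`, each
generic in the orthogonal complement of the vectors at its neighbours in `S`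
(`IsCactus.exists_isComplRep`). By `IsCactus.eq_of_two_neighbors` a new vertex has at most two such
neighbours. Those two are linked outside `S` beforehand, so the conditions in `IsComplRep` on linked
pairs are exactly what keeps the next generic choice possible. In a tree no pairs are linked, and
dimension 3 suffices. -/

namespace SimpleGraph

/-! ### Cycles and connected sets in cactus graphs -/

section Cactus

variable {V : Type*} {G : SimpleGraph V}

/-- In a cactus graph, two paths joining the ends of an edge and avoiding that edge have the same
edges. -/
theorem IsCactus.edges_subset_edges (hG : G.IsCactus) {a b : V} (h : G.Adj a b)
    {p q : G.Walk b a} (hp : p.IsPath) (hq : q.IsPath) (hpe : s(a, b) ∉ p.edges)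
    (hqe : s(a, b) ∉ q.edges) : p.edges ⊆ q.edges := by
  intro e he
  have h1 := hG.2 (e := s(a, b)) (Walk.cons h p) (Walk.cons h q)
    ((Walk.cons_isCycle_iff p h).2 ⟨hp, hpe⟩) ((Walk.cons_isCycle_iff q h).2 ⟨hq, hqe⟩)
    (by simp) (by simp)
  have h2 : e ∈ (Walk.cons h q).toSubgraph.edgeSet := by
    rw [← h1, Walk.mem_edges_toSubgraph]
    simp [he]
  rw [Walk.mem_edges_toSubgraph, Walk.edges_cons, List.mem_cons] at h2
  rcases h2 with rfl | h2
  · exact absurd he hpe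
  · exact h2

/-- In a cactus graph, if the ends of an edge are joined in two subgraphs that avoid the edge,
then they are joined in the intersection of these subgraphs. -/
theorem IsCactus.reachable_inf (hG : G.IsCactus) {a b : V} (h : G.Adj a b)
    {H K : SimpleGraph V} (hH : H ≤ G) (hK : K ≤ G) (hHe : ¬ H.Adj a b) (hKe : ¬ K.Adj a b)
    (h1 : H.Reachable b a) (h2 : K.Reachable b a) : (H ⊓ K).Reachable b a := by
  obtain ⟨p, hp⟩ := h1.exists_isPath
  obtain ⟨q, hq⟩ := h2.exists_isPath
  have key := hG.edges_subset_edges h (hp.mapLe hH) (hq.mapLe hK)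
    (by rw [Walk.edges_mapLe_eq_edges]; exact fun he => hHe (p.edges_subset_edgeSet he))
    (by rw [Walk.edges_mapLe_eq_edges]; exact fun he => hKe (q.edges_subset_edgeSet he))
  rw [Walk.edges_mapLe_eq_edges, Walk.edges_mapLe_eq_edges] at key
  refine ⟨p.transfer (H ⊓ K) fun e he => ?_⟩
  rw [edgeSet_inf]
  exact ⟨p.edges_subset_edgeSet he, q.edges_subset_edgeSet (key he)⟩

/-- The spanning subgraph formed by the edges with both ends in `S`. -/
def within (G : SimpleGraph V) (S : Set V) : SimpleGraph V where
  Adj a b := G.Adj a b ∧ a ∈ S ∧ b ∈ S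
  symm := ⟨fun _ _ h => ⟨h.1.symm, h.2.2, h.2.1⟩⟩
  loopless := ⟨fun _ h => h.1.ne rfl⟩

theorem within_adj {S : Set V} {a b : V} : (G.within S).Adj a b ↔ G.Adj a b ∧ a ∈ S ∧ b ∈ S :=
  Iff.rfl

theorem within_le (G : SimpleGraph V) (S : Set V) : G.within S ≤ G := fun _ _ h => h.1

theorem within_mono (G : SimpleGraph V) {S T : Set V} (h : S ⊆ T) : G.within S ≤ G.within T :=
  fun _ _ hab => ⟨hab.1, h hab.2.1, h hab.2.2⟩

/-- The graph `G` induces a connected graph on `S`. -/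
def ConnectedOn (G : SimpleGraph V) (S : Set V) : Prop :=
  ∀ a ∈ S, ∀ b ∈ S, (G.within S).Reachable a b

theorem ConnectedOn.insert {S : Set V} (hS : G.ConnectedOn S) {s v : V} (hs : s ∈ S)
    (hsv : G.Adj s v) : G.ConnectedOn (insert v S) := by
  have h0 : ∀ a ∈ Insert.insert v S, (G.within (Insert.insert v S)).Reachable a s := by
    rintro a (rfl | ha)
    · exact Adj.reachable ⟨hsv.symm, by simp, by simp [hs]⟩
    · exact (hS a ha s hs).mono (G.within_mono (by simp))
  exact fun a ha b hb => (h0 a ha).trans (h0 b hb).symm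

/-- The vertices `a` and `b` are both adjacent to one component of the graph outside `S`. -/
def Linked (G : SimpleGraph V) (S : Set V) (a b : V) : Prop :=
  ∃ v w, v ∉ S ∧ w ∉ S ∧ G.Adj a v ∧ G.Adj b w ∧ (G.within Sᶜ).Reachable v w

theorem Linked.symm {S : Set V} {a b : V} (h : G.Linked S a b) : G.Linked S b a := by
  obtain ⟨v, w, hv, hw, hav, hbw, h⟩ := h
  exact ⟨w, v, hw, hv, hbw, hav, h.symm⟩

/-- A larger set leaves less room outside. Hence growing `S` creates no new linked pairs among old
vertices, and conditions on linked pairs persist. -/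
theorem Linked.anti {S T : Set V} (hST : S ⊆ T) {a b : V} (h : G.Linked T a b) :
    G.Linked S a b := by
  obtain ⟨v, w, hv, hw, hav, hbw, h⟩ := h
  exact ⟨v, w, fun h => hv (hST h), fun h => hw (hST h), hav, hbw,
    h.mono (G.within_mono (Set.compl_subset_compl.2 hST))⟩

/-- If no edge leaves `S`, then no vertex outside `S` is joined to a vertex of `S`. -/
theorem not_reachable_of_forall_adj_mem {H : SimpleGraph V} {S : Set V}
    (hH : ∀ a b, H.Adj a b → a ∈ S → b ∈ S) {a b : V} (ha : a ∈ S) (hb : b ∉ S) :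
    ¬ H.Reachable b a := by
  intro h
  obtain ⟨p⟩ := h.symm
  obtain ⟨d, -, hd1, hd2⟩ := p.exists_boundary_dart S ha hb
  exact hd2 (hH _ _ d.adj hd1)

/-- Let `S` be connected in the cactus graph `G`. If a vertex outside `S` has two neighbours
in `S`, then its component outside `S` is joined to `S` only by the two edges to these. -/
theorem IsCactus.eq_of_two_neighbors (hG : G.IsCactus) {S : Set V} (hS : G.ConnectedOn S)
    {v s₁ s₂ s₃ w : V} (hv : v ∉ S) (h₁ : s₁ ∈ S) (h₂ : s₂ ∈ S) (h₃ : s₃ ∈ S) (h12 : s₁ ≠ s₂)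
    (a₁ : G.Adj s₁ v) (a₂ : G.Adj s₂ v) (hw : w ∉ S) (a₃ : G.Adj s₃ w)
    (hvw : (G.within Sᶜ).Reachable v w) : w = v ∧ (s₃ = s₁ ∨ s₃ = s₂) := by
  by_contra hcon
  -- `B` has no edge crossing the boundary of `S`. Adding the crossing edge `s₂v`, or instead `s₃w`,
  -- joins `v` to `s₁` without using `s₁v`. If the two crossing edges differ, the intersection of
  -- these graphs has no crossing edge, contradicting `reachable_inf`.
  set B := G.within S ⊔ G.within Sᶜ with hB
  have hBG : B ≤ G := sup_le (G.within_le S) (G.within_le Sᶜ)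
  have hBS : ∀ a b, B.Adj a b → (a ∈ S ↔ b ∈ S) := by
    rintro a b (h | h)
    · simp [h.2.1, h.2.2]
    · have h1 := h.2.1
      have h2 := h.2.2
      simp only [Set.mem_compl_iff] at h1 h2
      simp [h1, h2]
  have adj_iff : ∀ s t a b : V, (B ⊔ edge s t).Adj a b ↔
      B.Adj a b ∨ ((a = s ∧ b = t ∨ a = t ∧ b = s) ∧ a ≠ b) := by
    intro s t a b
    rw [sup_adj, edge_adj]
  have hv1 : v ≠ s₁ := fun h => hv (h ▸ h₁)
  have hv2 : v ≠ s₂ := fun h => hv (h ▸ h₂)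
  have hw1 : w ≠ s₁ := fun h => hw (h ▸ h₁)
  have hw2 : w ≠ s₂ := fun h => hw (h ▸ h₂)
  have hw3 : w ≠ s₃ := fun h => hw (h ▸ h₃)
  have hv3 : v ≠ s₃ := fun h => hv (h ▸ h₃)
  have R₁ : (B ⊔ edge s₂ v).Reachable v s₁ := by
    refine Reachable.trans (v := s₂) (Adj.reachable ?_) ((hS s₂ h₂ s₁ h₁).mono ?_)
    · rw [adj_iff]; simp [hv2]
    · exact le_sup_left.trans le_sup_left
  have R₂ : (B ⊔ edge s₃ w).Reachable v s₁ := by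
    refine Reachable.trans (v := w) (hvw.mono (le_sup_right.trans le_sup_left)) ?_
    refine Reachable.trans (v := s₃) (Adj.reachable ?_) ((hS s₃ h₃ s₁ h₁).mono ?_)
    · rw [adj_iff]; simp [hw3]
    · exact le_sup_left.trans le_sup_left
  have nB : ¬ B.Adj s₁ v := fun h => hv ((hBS _ _ h).1 h₁)
  have le : ∀ s t : V, G.Adj s t → B ⊔ edge s t ≤ G := fun s t h =>
    sup_le hBG ((edge_le_iff _).2 (Or.inr h))
  by_cases hc : w = v ∧ s₃ = s₁
  · exact hcon ⟨hc.1, Or.inl hc.2⟩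
  have := hG.reachable_inf a₁ (le _ _ a₂) (le _ _ a₃)
    (by rw [adj_iff]; grind) (by rw [adj_iff]; grind) R₁ R₂
  refine not_reachable_of_forall_adj_mem (S := S) ?_ h₁ hv this
  intro a b hab ha
  rw [inf_adj, adj_iff, adj_iff] at hab
  have := hBS a b
  grind

/-- In an acyclic graph, two vertices of a connected set are not linked outside that set. -/
theorem IsAcyclic.not_linked (hG : G.IsAcyclic) {S : Set V} (hS : G.ConnectedOn S) {a b : V}
    (ha : a ∈ S) (hb : b ∈ S) (hab : a ≠ b) : ¬ G.Linked S a b := by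
  rintro ⟨v, w, hv, hw, hav, hbw, h⟩
  -- The edge `av` would be a bridge, yet it is bypassed by going from `a` to `b` inside `S`, across
  -- `bw`, and back to `v` outside `S`.
  have h1 := isBridge_iff.1 (isAcyclic_iff_forall_isBridge.1 hG (e := s(a, v)) hav)
  apply h1
  have le1 : G.within S ≤ G.deleteEdges {s(a, v)} := by
    intro x y hxy
    rw [within_adj] at hxy
    rw [deleteEdges_adj]
    refine ⟨hxy.1, ?_⟩
    simp only [Set.mem_singleton_iff, Sym2.eq_iff]
    grind
  have le2 : G.within Sᶜ ≤ G.deleteEdges {s(a, v)} := by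
    intro x y hxy
    rw [within_adj] at hxy
    rw [deleteEdges_adj]
    refine ⟨hxy.1, ?_⟩
    simp only [Set.mem_singleton_iff, Sym2.eq_iff]
    have h1 := hxy.2.1
    have h2 := hxy.2.2
    simp only [Set.mem_compl_iff] at h1 h2
    grind
  refine ((hS a ha b hb).mono le1).trans (Reachable.trans (v := w) (Adj.reachable ?_)
    ((h.mono le2).symm))
  rw [deleteEdges_adj]
  refine ⟨hbw, ?_⟩
  simp only [Set.mem_singleton_iff, Sym2.eq_iff]
  grind

end Cactus

/-! ### Weighted Laplacians and the rank bound for a graph -/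

section Laplacian

variable (𝕜 : Type*) [RCLike 𝕜] {V : Type*} [DecidableEq V]

/-- The Laplacian matrix of a single edge. -/
def edgeLap : Sym2 V → Matrix V V 𝕜 :=
  Sym2.lift ⟨fun a b => Matrix.vecMulVec (Pi.single a 1 - Pi.single b 1)
    (Pi.single a 1 - Pi.single b 1), fun a b => by
      beta_reduce
      rw [← neg_sub (Pi.single b 1), Matrix.neg_vecMulVec, Matrix.vecMulVec_neg, neg_neg]⟩

/-- The squared modulus of the difference of the values of `x` at the two ends of an edge. -/
noncomputable def edgeSq {𝕜 : Type*} [RCLike 𝕜] {V : Type*} (x : V → 𝕜) : Sym2 V → ℝ :=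
  Sym2.lift ⟨fun a b => ‖x a - x b‖ ^ 2, fun a b => by
    beta_reduce
    rw [norm_sub_rev]⟩

theorem edgeSq_mk {𝕜 : Type*} [RCLike 𝕜] {V : Type*} (x : V → 𝕜) (a b : V) :
    edgeSq x s(a, b) = ‖x a - x b‖ ^ 2 := rfl

theorem edgeSq_nonneg {𝕜 : Type*} [RCLike 𝕜] {V : Type*} (x : V → 𝕜) (e : Sym2 V) :
    0 ≤ edgeSq x e := by
  induction e with | _ a b => exact sq_nonneg _

theorem edgeLap_isHermitian (e : Sym2 V) : (edgeLap 𝕜 e).IsHermitian := by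
  induction e with | _ a b =>
  ext i j
  simp only [edgeLap, Sym2.lift_mk, Matrix.conjTranspose_apply, Matrix.vecMulVec_apply,
    Pi.sub_apply, Pi.single_apply]
  split_ifs <;> simp

theorem edgeLap_apply {e : Sym2 V} {i j : V} (hij : i ≠ j) :
    edgeLap 𝕜 e i j = if e = s(i, j) then -1 else 0 := by
  induction e with | _ a b =>
  simp only [edgeLap, Sym2.lift_mk, Matrix.vecMulVec_apply, Pi.sub_apply, Pi.single_apply,
    Sym2.eq_iff]
  by_cases h1 : i = a <;> by_cases h2 : i = b <;> by_cases h3 : j = a <;> by_cases h4 : j = b <;>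
    simp_all [eq_comm]

theorem star_dotProduct_edgeLap_mulVec [Fintype V] (x : V → 𝕜) (e : Sym2 V) :
    star x ⬝ᵥ (edgeLap 𝕜 e).mulVec x = (edgeSq x e : 𝕜) := by
  induction e with | _ a b =>
  simp only [edgeLap, Sym2.lift_mk, edgeSq_mk, Matrix.vecMulVec_mulVec]
  simp only [dotProduct_smul, sub_dotProduct, dotProduct_sub, single_one_dotProduct,
    dotProduct_single_one, Pi.star_apply, MulOpposite.smul_eq_mul_unop, MulOpposite.unop_op]
  rw [← star_sub, RCLike.star_def, RCLike.conj_mul]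
  push_cast
  rfl

/-- A weighting of the edges of `G` by nonzero reals whose Laplacian form is nonnegative and
vanishes at `k` independent vectors gives `msr G ≤ |G| - k`. -/
theorem msr_add_le_of_weights [Fintype V] {G : SimpleGraph V} [Fintype G.edgeSet] (c : Sym2 V → ℝ)
    (hc : ∀ e ∈ G.edgeSet, c e ≠ 0)
    (hnonneg : ∀ x : V → 𝕜, 0 ≤ ∑ e ∈ G.edgeFinset, c e * edgeSq x e)
    {k : ℕ} (y : Fin k → V → 𝕜) (hy : LinearIndependent 𝕜 y)
    (hzero : ∀ i, ∑ e ∈ G.edgeFinset, c e * edgeSq (y i) e = 0) :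
    G.msr 𝕜 + k ≤ Fintype.card V := by
  set A : Matrix V V 𝕜 := ∑ e ∈ G.edgeFinset, (c e : 𝕜) • edgeLap 𝕜 e with hA
  have hform : ∀ x : V → 𝕜, star x ⬝ᵥ A.mulVec x =
      ((∑ e ∈ G.edgeFinset, c e * edgeSq x e : ℝ) : 𝕜) := by
    intro x
    rw [hA, Matrix.sum_mulVec, dotProduct_sum]
    push_cast
    refine Finset.sum_congr rfl fun e _ => ?_
    rw [Matrix.smul_mulVec, dotProduct_smul, star_dotProduct_edgeLap_mulVec, smul_eq_mul]
  have hpsd : A.PosSemidef := by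
    refine Matrix.PosSemidef.of_dotProduct_mulVec_nonneg ?_ fun x => ?_
    · rw [Matrix.IsHermitian, hA, Matrix.conjTranspose_sum]
      refine Finset.sum_congr rfl fun e _ => ?_
      rw [Matrix.conjTranspose_smul, (edgeLap_isHermitian 𝕜 e).eq]
      simp
    · rw [hform]
      exact_mod_cast hnonneg x
  have hmem : A ∈ G.psdMatrices 𝕜 := by
    refine ⟨hpsd, fun i j hij => ?_⟩
    have : A i j = if s(i, j) ∈ G.edgeFinset then -(c s(i, j) : 𝕜) else 0 := by
      rw [hA, Matrix.sum_apply]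
      simp only [Matrix.smul_apply, edgeLap_apply 𝕜 hij, smul_eq_mul, mul_ite, mul_neg, mul_one,
        mul_zero, Finset.sum_ite_eq']
    rw [this]
    by_cases h : G.Adj i j
    · simp [h, hc s(i, j) h]
    · simp [h]
  -- For a positive semidefinite matrix, the zeros of the quadratic form are the kernel.
  have hker : k ≤ Module.finrank 𝕜 (LinearMap.ker A.mulVecLin) := by
    have hm : ∀ i, y i ∈ LinearMap.ker A.mulVecLin := by
      intro i
      rw [LinearMap.mem_ker, Matrix.mulVecLin_apply, ← hpsd.dotProduct_mulVec_zero_iff, hform,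
        hzero, RCLike.ofReal_zero]
    have hli : LinearIndependent 𝕜 (fun i => (⟨y i, hm i⟩ : LinearMap.ker A.mulVecLin)) :=
      LinearIndependent.of_comp (LinearMap.ker A.mulVecLin).subtype hy
    simpa using hli.fintype_card_le_finrank
  have hrk := LinearMap.finrank_range_add_finrank_ker A.mulVecLin
  rw [Module.finrank_fintype_fun_eq_card] at hrk
  have hle : G.msr 𝕜 ≤ A.rank := Nat.sInf_le ⟨A, hmem, rfl⟩
  rw [Matrix.rank] at hle
  omega

/-- A graph on a nonempty vertex set has minimum semidefinite rank less than its order. -/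
theorem msr_add_one_le_card [Fintype V] [Nonempty V] (G : SimpleGraph V) :
    G.msr 𝕜 + 1 ≤ Fintype.card V := by
  classical
  refine msr_add_le_of_weights 𝕜 (fun _ => 1) (fun _ _ => one_ne_zero)
    (fun x => Finset.sum_nonneg fun e _ => by simpa using edgeSq_nonneg x e)
    (fun _ : Fin 1 => fun _ => 1) ?_ ?_
  · rw [linearIndependent_unique_iff]
    exact fun h => one_ne_zero (congrFun h (Classical.arbitrary V))
  · intro _
    refine Finset.sum_eq_zero fun e _ => ?_
    induction e with | _ a b => simp [edgeSq_mk]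

/-- The Cauchy-Schwarz inequality along a walk. -/
theorem Walk.edgeSq_le {𝕜 : Type*} [RCLike 𝕜] {V : Type*} {G : SimpleGraph V} (x : V → 𝕜)
    {a b : V} (p : G.Walk a b) :
    ‖x a - x b‖ ^ 2 ≤ p.length * (p.edges.map (edgeSq x)).sum := by
  induction p with
  | nil => simp
  | @cons a d b h p ih =>
    rw [Walk.length_cons, Walk.edges_cons, List.map_cons, List.sum_cons, edgeSq_mk]
    set s := (p.edges.map (edgeSq x)).sum
    have hs : 0 ≤ s := List.sum_nonneg (by
      intro t ht
      obtain ⟨e, -, rfl⟩ := List.mem_map.1 ht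
      exact edgeSq_nonneg x e)
    have htri : ‖x a - x b‖ ≤ ‖x a - x d‖ + ‖x d - x b‖ := norm_sub_le_norm_sub_add_norm_sub _ _ _
    set α := ‖x a - x d‖
    set β := ‖x d - x b‖
    set m : ℝ := (p.length : ℝ)
    have hα : 0 ≤ α := norm_nonneg _
    have hβ : 0 ≤ β := norm_nonneg _
    have hm : 0 ≤ m := Nat.cast_nonneg _
    have h1 : ‖x a - x b‖ ^ 2 ≤ (α + β) ^ 2 := by gcongr
    push_cast
    -- By induction `β² ≤ m s`, so `(2αβ)² ≤ 4 (m α²) s`, and AM-GM applies.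
    have h2 : 2 * α * β ≤ m * α ^ 2 + s := by
      have h3 : (2 * α * β) ^ 2 ≤ (m * α ^ 2 + s) ^ 2 := by
        nlinarith [mul_le_mul_of_nonneg_left ih (sq_nonneg α), sq_nonneg (m * α ^ 2 - s)]
      exact abs_le_of_sq_le_sq' h3 (by positivity) |>.2
    nlinarith

end Laplacian

/-! ### A second kernel vector from a cycle -/

theorem edgeSq_natCast (𝕜 : Type*) [RCLike 𝕜] {V : Type*} (n : V → ℕ) (a b : V) :
    edgeSq (fun v => (n v : 𝕜)) s(a, b) = ((n a : ℝ) - n b) ^ 2 := by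
  have : (n a : 𝕜) - n b = (((n a : ℝ) - n b : ℝ) : 𝕜) := by push_cast; rfl
  rw [edgeSq_mk, this, RCLike.norm_ofReal, sq_abs]

/-- The minimum semidefinite rank of a cactus graph of order `n` that is not a tree is at most
`n - 2`. -/
theorem IsCactus.msr_add_two_le_card (𝕜 : Type*) [RCLike 𝕜] {V : Type*} [Fintype V]
    {G : SimpleGraph V} (hG : G.IsCactus) (hcyc : ¬ G.IsAcyclic) :
    G.msr 𝕜 + 2 ≤ Fintype.card V := by
  classical
  rw [IsAcyclic] at hcyc
  push Not at hcyc
  obtain ⟨u, p, hp⟩ := hcyc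
  cases p with
  | nil => exact absurd hp Walk.not_isCycle_nil
  | @cons _ w _ h q =>
  obtain ⟨hq, hfq⟩ := (Walk.cons_isCycle_iff q h).1 hp
  set f := s(u, w) with hf
  set P := q.edges.toFinset with hP
  set m := q.length with hm
  have hcard : P.card = m := by
    rw [hP, List.toFinset_card_of_nodup hq.isTrail.edges_nodup, Walk.length_edges]
  have hm0 : m ≠ 0 := fun h0 => h.ne (Walk.eq_of_length_eq_zero h0).symm
  have hfP : f ∉ P := by simpa [hP] using hfq
  have hPG : P ⊆ G.edgeFinset := fun e he => by
    rw [mem_edgeFinset]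
    exact q.edges_subset_edgeSet (List.mem_toFinset.1 he)
  have hfG : f ∈ G.edgeFinset := mem_edgeFinset.2 h
  -- The climbing function: it counts the edges of the path `P` that separate `v` from `w` once `f`
  -- is removed. It goes from `0` at `w` to `m` at `u`, and changes only across cycle edges.
  let cnt : V → ℕ := fun v => (P.filter fun e => ¬ (G.deleteEdges {f, e}).Reachable w v).card
  have hcntw : cnt w = 0 := by
    simp [cnt]
  have hcntu : cnt u = m := by
    rw [← hcard]
    -- By the cactus property, every path from `w` to `u` avoiding `f` contains all of `P`, so each
    -- edge of `P` separates.
    refine congrArg Finset.card (Finset.filter_true_of_mem fun e he hr => ?_)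
    obtain ⟨r, hr⟩ := hr.exists_isPath
    have hle : G.deleteEdges {f, e} ≤ G := deleteEdges_le _
    have hsub := hG.edges_subset_edges h hq (hr.mapLe hle) hfq (by
      rw [Walk.edges_mapLe_eq_edges]
      intro hmem
      have := r.edges_subset_edgeSet hmem
      simp [hf] at this)
    have hmem := hsub (List.mem_toFinset.1 he)
    rw [Walk.edges_mapLe_eq_edges] at hmem
    have := r.edges_subset_edgeSet hmem
    simp at this
  have hreach : ∀ a b e, G.Adj a b → s(a, b) ≠ f → s(a, b) ≠ e →
      ((G.deleteEdges {f, e}).Reachable w a ↔ (G.deleteEdges {f, e}).Reachable w b) := by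
    intro a b e hab h1 h2
    have hadj : (G.deleteEdges {f, e}).Adj a b := by
      rw [deleteEdges_adj]
      exact ⟨hab, by simp [h1, h2]⟩
    exact ⟨fun h => h.trans hadj.reachable, fun h => h.trans hadj.symm.reachable⟩
  have hcnt_eq : ∀ a b, G.Adj a b → s(a, b) ≠ f → s(a, b) ∉ P → cnt a = cnt b := by
    intro a b hab h1 h2
    refine congrArg Finset.card (Finset.filter_congr fun e he => ?_)
    rw [hreach a b e hab h1 (fun h => h2 (h ▸ he))]
  have hcnt_le : ∀ a b, G.Adj a b → s(a, b) ≠ f → cnt a ≤ cnt b + 1 := by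
    intro a b hab h1
    refine (Finset.card_le_card ?_).trans (Finset.card_insert_le s(a, b) _)
    intro e he
    rw [Finset.mem_filter] at he
    rw [Finset.mem_insert, Finset.mem_filter]
    by_cases h2 : s(a, b) = e
    · exact Or.inl h2.symm
    · exact Or.inr ⟨he.1, by rw [← hreach a b e hab h1 h2]; exact he.2⟩
  -- The weight `m` is the Cauchy-Schwarz constant of a path of length `m`.
  let c : Sym2 V → ℝ := fun e => if e = f then -1 else if e ∈ P then m else 1
  have hsum : ∀ g : Sym2 V → ℝ, ∑ e ∈ G.edgeFinset,
      ((if e ∈ P then m * g e else 0) - if e = f then g e else 0) = m * ∑ e ∈ P, g e - g f := by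
    intro g
    rw [Finset.sum_sub_distrib, Finset.sum_ite_mem, Finset.inter_eq_right.2 hPG,
      Finset.sum_ite_eq', if_pos hfG, Finset.mul_sum]
  have hnonneg : ∀ x : V → 𝕜, 0 ≤ ∑ e ∈ G.edgeFinset, c e * edgeSq x e := by
    intro x
    have h1 := q.edgeSq_le x
    rw [← List.sum_toFinset _ hq.isTrail.edges_nodup] at h1
    have h2 : edgeSq x f = ‖x w - x u‖ ^ 2 := by rw [hf, edgeSq_mk, norm_sub_rev]
    calc (0 : ℝ) ≤ m * ∑ e ∈ P, edgeSq x e - edgeSq x f := by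
          rw [h2]
          exact sub_nonneg.2 h1
      _ = _ := (hsum _).symm
      _ ≤ _ := by
          refine Finset.sum_le_sum fun e _ => ?_
          have h0 := edgeSq_nonneg x e
          simp only [c]
          by_cases he : e = f
          · subst he
            simp [hfP]
          · by_cases heP : e ∈ P <;> simp [he, heP, h0]
  refine msr_add_le_of_weights 𝕜 c ?_ hnonneg ![fun _ => 1, fun v => (cnt v : 𝕜)] ?_ ?_
  · intro e _
    simp only [c]
    split_ifs <;> simp [hm0]
  · rw [LinearIndependent.pair_iff]
    intro s t hst
    have h1 := congrFun hst w
    have h2 := congrFun hst u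
    simp only [Pi.add_apply, Pi.smul_apply, smul_eq_mul, hcntw, hcntu, Pi.zero_apply,
      Nat.cast_zero, mul_zero, mul_one, add_zero] at h1 h2
    subst h1
    simpa [hm0] using h2
  · intro i
    fin_cases i
    · refine Finset.sum_eq_zero fun e _ => ?_
      induction e with | _ a b => simp [edgeSq_mk]
    -- Edges of `P` contribute at most `m` each, `m²` in total; `f` contributes `-m²` and the other
    -- edges nothing.
    · refine le_antisymm ?_ (hnonneg _)
      set x : V → 𝕜 := fun v => (cnt v : 𝕜) with hx
      have hxf : edgeSq x f = (m : ℝ) ^ 2 := by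
        rw [hf, hx, edgeSq_natCast, hcntu, hcntw]
        simp
      have hxP : ∀ e ∈ G.edgeFinset, e ≠ f → edgeSq x e ≤ 1 := by
        intro e he hef
        induction e with | _ a b =>
        rw [mem_edgeFinset, mem_edgeSet] at he
        have h1 := hcnt_le a b he hef
        have h2 := hcnt_le b a he.symm (by rwa [Sym2.eq_swap])
        rw [hx, edgeSq_natCast, sq_le_one_iff_abs_le_one, abs_le]
        have h1' : (cnt a : ℝ) ≤ cnt b + 1 := by exact_mod_cast h1
        have h2' : (cnt b : ℝ) ≤ cnt a + 1 := by exact_mod_cast h2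
        constructor <;> linarith
      have hx0 : ∀ e ∈ G.edgeFinset, e ≠ f → e ∉ P → edgeSq x e = 0 := by
        intro e he hef heP
        induction e with | _ a b =>
        rw [mem_edgeFinset, mem_edgeSet] at he
        rw [hx, edgeSq_natCast, hcnt_eq a b he hef heP]
        simp
      calc ∑ e ∈ G.edgeFinset, c e * edgeSq x e
          = ∑ e ∈ G.edgeFinset, ((if e ∈ P then m * edgeSq x e else 0) -
              if e = f then edgeSq x e else 0) := by
            refine Finset.sum_congr rfl fun e he => ?_
            simp only [c]
            by_cases hef : e = f
            · subst hef
              simp [hfP]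
            · by_cases heP : e ∈ P
              · simp [hef, heP]
              · simp [hef, heP, hx0 e he hef heP]
        _ = m * ∑ e ∈ P, edgeSq x e - edgeSq x f := hsum _
        _ ≤ m * ∑ e ∈ P, 1 - edgeSq x f := by
            gcongr with e he
            exact hxP e (hPG he) fun h => hfP (h ▸ he)
        _ = 0 := by
            rw [hxf, Finset.sum_const, hcard]
            simp [sq]

/-! ### Orthogonal representations of the complement -/

section Representation

open Module Submodule

/-- A subspace contained in none of finitely many subspaces has an element outside all of them. -/
theorem exists_mem_forall_notMem {𝕜 E ι : Type*} [Field 𝕜] [Infinite 𝕜] [AddCommGroup E]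
    [Module 𝕜 E] [Finite ι] (W : Submodule 𝕜 E) (U : ι → Submodule 𝕜 E)
    (h : ∀ i, ¬ W ≤ U i) : ∃ y ∈ W, ∀ i, y ∉ U i := by
  classical
  have := Fintype.ofFinite ι
  -- A vector space over an infinite field is not a finite union of proper subspaces.
  have h1 := Subspace.biUnion_ne_univ_of_top_notMem (k := 𝕜) (E := W)
    (s := Finset.univ.image fun i => (U i).comap W.subtype) (by
      intro ht
      obtain ⟨i, -, hi⟩ := Finset.mem_image.1 ht
      exact h i fun y hy => by
        have : (⟨y, hy⟩ : W) ∈ (U i).comap W.subtype := hi ▸ Submodule.mem_top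
        exact this)
  obtain ⟨y, hy⟩ := (Set.ne_univ_iff_exists_notMem _).1 h1
  refine ⟨y, y.2, fun i hi => hy ?_⟩
  simp only [Finset.mem_image, Finset.mem_univ, true_and, Set.mem_iUnion, SetLike.mem_coe]
  exact ⟨_, ⟨i, rfl⟩, hi⟩

variable {𝕜 : Type*} [RCLike 𝕜] {V : Type*} {G : SimpleGraph V}
  {E : Type*} [NormedAddCommGroup E] [InnerProductSpace 𝕜 E]

/-- An orthogonal representation on `S` of the complement of `G`: vectors at distinct vertices
of `S` are orthogonal exactly when the vertices are adjacent in `G`, no two vectors are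
parallel, and the vectors at two linked vertices span no other of the vectors. -/
structure IsComplRep (𝕜 : Type*) [RCLike 𝕜] {V : Type*} (G : SimpleGraph V)
    {E : Type*} [NormedAddCommGroup E] [InnerProductSpace 𝕜 E] (S : Set V) (x : V → E) :
    Prop where
  ne_zero : ∀ a ∈ S, x a ≠ 0
  inner_eq_zero_iff : ∀ a ∈ S, ∀ b ∈ S, a ≠ b → (inner 𝕜 (x a) (x b) = 0 ↔ G.Adj a b)
  notMem_span : ∀ a ∈ S, ∀ b ∈ S, a ≠ b → x a ∉ 𝕜 ∙ x b
  notMem_span_pair : ∀ a ∈ S, ∀ b ∈ S, ∀ z ∈ S, a ≠ b → z ≠ a → z ≠ b → G.Linked S a b →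
    x z ∉ span 𝕜 {x a, x b}

/-- A representation extends to a further vertex by a generic vector of a subspace `W`, if `W`
is not contained in any of the subspaces that the new vector has to avoid. -/
theorem IsComplRep.exists_insert [DecidableEq V] [Finite V] {S : Set V} {x : V → E}
    (hx : IsComplRep 𝕜 G S x) (hne : S.Nonempty) {v : V} (hv : v ∉ S) (W : Submodule 𝕜 E)
    (h1 : ∀ z ∈ S, G.Adj z v → W ≤ (𝕜 ∙ x z)ᗮ)
    (h2 : ∀ z ∈ S, ¬ G.Adj z v → ¬ W ≤ (𝕜 ∙ x z)ᗮ)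
    (h3 : ∀ z ∈ S, ¬ W ≤ 𝕜 ∙ x z)
    (h4 : ∀ a ∈ S, ∀ b ∈ S, a ≠ b → G.Linked (insert v S) a b → ¬ W ≤ span 𝕜 {x a, x b})
    (h5 : ∀ z ∈ S, ∀ b ∈ S, z ≠ b → G.Linked (insert v S) v b → ¬ W ≤ span 𝕜 {x z, x b}) :
    ∃ y : E, IsComplRep 𝕜 G (insert v S) (Function.update x v y) := by
  let ι := {z : V // z ∈ S ∧ ¬ G.Adj z v} ⊕ {z : V // z ∈ S} ⊕
    {p : V × V // p.1 ∈ S ∧ p.2 ∈ S ∧ p.1 ≠ p.2 ∧ G.Linked (insert v S) p.1 p.2} ⊕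
    {p : V × V // p.1 ∈ S ∧ p.2 ∈ S ∧ p.1 ≠ p.2 ∧ G.Linked (insert v S) v p.2}
  let U : ι → Submodule 𝕜 E := fun i => match i with
    | .inl z => (𝕜 ∙ x z)ᗮ
    | .inr (.inl z) => 𝕜 ∙ x z
    | .inr (.inr (.inl p)) => span 𝕜 {x p.1.1, x p.1.2}
    | .inr (.inr (.inr p)) => span 𝕜 {x p.1.1, x p.1.2}
  obtain ⟨y, hyW, hyU⟩ := exists_mem_forall_notMem W U (by
    rintro (z | z | p | p)
    · exact h2 _ z.2.1 z.2.2
    · exact h3 _ z.2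
    · exact h4 _ p.2.1 _ p.2.2.1 p.2.2.2.1 p.2.2.2.2
    · exact h5 _ p.2.1 _ p.2.2.1 p.2.2.2.1 p.2.2.2.2)
  have y1 : ∀ z ∈ S, (inner 𝕜 (x z) y = 0 ↔ G.Adj z v) := by
    intro z hz
    rw [← mem_orthogonal_singleton_iff_inner_right]
    refine ⟨fun h => ?_, fun h => h1 z hz h hyW⟩
    by_contra hcon
    exact hyU (.inl ⟨z, hz, hcon⟩) h
  have y2 : ∀ z ∈ S, y ∉ 𝕜 ∙ x z := fun z hz => hyU (.inr (.inl ⟨z, hz⟩))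
  have y3 : ∀ a ∈ S, ∀ b ∈ S, a ≠ b → G.Linked (insert v S) a b → y ∉ span 𝕜 {x a, x b} :=
    fun a ha b hb hab h => hyU (.inr (.inr (.inl ⟨(a, b), ha, hb, hab, h⟩)))
  have y4 : ∀ z ∈ S, ∀ b ∈ S, z ≠ b → G.Linked (insert v S) v b → y ∉ span 𝕜 {x z, x b} :=
    fun z hz b hb hzb h => hyU (.inr (.inr (.inr ⟨(z, b), hz, hb, hzb, h⟩)))
  have y0 : y ≠ 0 := by
    obtain ⟨z, hz⟩ := hne
    rintro rfl
    exact y2 z hz (zero_mem _)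
  -- Exchange: a nonzero coefficient of `y` would put `y` in the span of `x z` and `x b`, which was
  -- avoided.
  have y5 : ∀ z ∈ S, ∀ b ∈ S, z ≠ b → G.Linked (insert v S) v b → x z ∉ span 𝕜 {y, x b} := by
    intro z hz b hb hzb hl hmem
    obtain ⟨α, β, hαβ⟩ := mem_span_pair.1 hmem
    by_cases hα : α = 0
    · refine hx.notMem_span z hz b hb hzb (mem_span_singleton.2 ⟨β, ?_⟩)
      simpa [hα] using hαβ
    · refine y4 z hz b hb hzb hl (mem_span_pair.2 ⟨α⁻¹, -(α⁻¹ * β), ?_⟩)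
      rw [← hαβ, smul_add, smul_smul, smul_smul, inv_mul_cancel₀ hα]
      simp
  have hlink : ∀ {a b}, G.Linked (insert v S) a b → G.Linked S a b :=
    fun h => h.anti (Set.subset_insert v S)
  have hxS : ∀ a ∈ S, Function.update x v y a = x a := fun a ha =>
    Function.update_of_ne (ne_of_mem_of_not_mem ha hv) _ _
  have hxv : Function.update x v y v = y := Function.update_self _ _ _
  refine ⟨y, ?_, ?_, ?_, ?_⟩
  · rintro a (rfl | ha)
    · rwa [hxv]
    · rw [hxS a ha]
      exact hx.ne_zero a ha
  · rintro a (rfl | ha) b (rfl | hb) hab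
    · exact absurd rfl hab
    · rw [hxv, hxS b hb, inner_eq_zero_symm, y1 b hb, G.adj_comm]
    · rw [hxv, hxS a ha, y1 a ha]
    · rw [hxS a ha, hxS b hb]
      exact hx.inner_eq_zero_iff a ha b hb hab
  · rintro a (rfl | ha) b (rfl | hb) hab
    · exact absurd rfl hab
    · rw [hxv, hxS b hb]
      exact y2 b hb
    · rw [hxv, hxS a ha]
      intro hmem
      obtain ⟨α, hα⟩ := mem_span_singleton.1 hmem
      have hα0 : α ≠ 0 := by
        rintro rfl
        exact hx.ne_zero a ha (by simpa using hα.symm)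
      refine y2 a ha (mem_span_singleton.2 ⟨α⁻¹, ?_⟩)
      rw [← hα, smul_smul, inv_mul_cancel₀ hα0, one_smul]
    · rw [hxS a ha, hxS b hb]
      exact hx.notMem_span a ha b hb hab
  · rintro a (rfl | ha) b (rfl | hb) z (rfl | hz) hab hza hzb hl
    · exact absurd rfl hab
    · exact absurd rfl hab
    · exact absurd rfl hza
    · rw [hxv, hxS b hb, hxS z hz]
      exact y5 z hz b hb hzb hl
    · exact absurd rfl hzb
    · rw [hxv, hxS a ha, hxS z hz, Set.pair_comm]
      exact y5 z hz a ha hza hl.symm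
    · rw [hxv, hxS a ha, hxS b hb]
      exact y3 a ha b hb hab hl
    · rw [hxS a ha, hxS b hb, hxS z hz]
      exact hx.notMem_span_pair a ha b hb z hz hab hza hzb (hlink hl)

theorem finrank_span_pair_le (x y : E) : finrank 𝕜 (span 𝕜 {x, y}) ≤ 2 := by
  classical
  have := finrank_span_finset_le_card (R := 𝕜) ({x, y} : Finset E)
  rw [Set.finrank, Finset.coe_pair] at this
  exact this.trans Finset.card_le_two

theorem not_le_of_finrank_lt [FiniteDimensional 𝕜 E] {U W : Submodule 𝕜 E}
    (h : finrank 𝕜 U < finrank 𝕜 W) : ¬ W ≤ U :=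
  fun hle => absurd (Submodule.finrank_mono hle) (not_le.2 h)

/-- A representation extends to a further vertex with one neighbour `s`. -/
theorem IsComplRep.exists_insert_of_one [DecidableEq V] [Finite V] [FiniteDimensional 𝕜 E]
    {S : Set V} {x : V → E} (hx : IsComplRep 𝕜 G S x) {s v : V} (hs : s ∈ S) (hv : v ∉ S)
    (hsv : G.Adj s v) (huniq : ∀ z ∈ S, G.Adj z v → z = s) (hdim : 3 ≤ finrank 𝕜 E)
    (hlink : finrank 𝕜 E = 3 → ∀ a b, a ∈ insert v S → b ∈ insert v S → a ≠ b →
      ¬ G.Linked (insert v S) a b) :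
    ∃ y : E, IsComplRep 𝕜 G (insert v S) (Function.update x v y) := by
  have hW : finrank 𝕜 (𝕜 ∙ x s)ᗮ + 1 = finrank 𝕜 E := by
    rw [← finrank_add_finrank_orthogonal (𝕜 ∙ x s), finrank_span_singleton (hx.ne_zero s hs),
      add_comm]
  have hne : ∀ a ∈ S, v ≠ a := fun a ha h => hv (h ▸ ha)
  have hpair : ∀ a b c d, c ∈ insert v S → d ∈ insert v S → c ≠ d → G.Linked (insert v S) c d →
      ¬ (𝕜 ∙ x s)ᗮ ≤ span 𝕜 {x a, x b} := by
    intro a b c d hc hd hcd hl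
    -- In dimension 3 the hyperplane could equal the span of a pair; from dimension 4 on it is too
    -- large.
    have h3 : finrank 𝕜 E ≠ 3 := fun h => hlink h c d hc hd hcd hl
    exact not_le_of_finrank_lt (by have := finrank_span_pair_le (𝕜 := 𝕜) (x a) (x b); omega)
  refine hx.exists_insert ⟨s, hs⟩ hv (𝕜 ∙ x s)ᗮ ?_ ?_ ?_ ?_ ?_
  · intro z hz hzv
    rw [huniq z hz hzv]
  · intro z hz hzv
    rw [orthogonal_le_orthogonal_iff, span_singleton_le_iff_mem]
    exact hx.notMem_span z hz s hs (by rintro rfl; exact hzv hsv)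
  · intro z hz
    exact not_le_of_finrank_lt (by rw [finrank_span_singleton (hx.ne_zero z hz)]; omega)
  · intro a ha b hb hab hl
    exact hpair a b a b (by simp [ha]) (by simp [hb]) hab hl
  · intro z hz b hb hzb hl
    exact hpair z b v b (by simp) (by simp [hb]) (hne b hb) hl

/-- A representation of the complement of a cactus graph on a connected set extends to a further
vertex with two neighbours `s` and `t`, in a space of dimension `4`. -/
theorem IsComplRep.exists_insert_of_two [DecidableEq V] [Finite V] [FiniteDimensional 𝕜 E]
    (hG : G.IsCactus) {S : Set V} (hS : G.ConnectedOn S)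
    {x : V → E} (hx : IsComplRep 𝕜 G S x) {s t v : V} (hs : s ∈ S) (ht : t ∈ S) (hst : s ≠ t)
    (hv : v ∉ S) (hsv : G.Adj s v) (htv : G.Adj t v) (hdim : finrank 𝕜 E = 4) :
    ∃ y : E, IsComplRep 𝕜 G (insert v S) (Function.update x v y) := by
  set K : Submodule 𝕜 E := span 𝕜 {x s, x t} with hK
  -- Linked through `v` itself: hence no vector at a third vertex lies in `K`, which is what
  -- non-neighbours of `v` require.
  have hls : G.Linked S s t := ⟨v, v, hv, hv, hsv, htv, Reachable.refl v⟩
  have hK2 : finrank 𝕜 K = 2 := by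
    have hli : LinearIndependent 𝕜 ![x s, x t] := by
      rw [LinearIndependent.pair_iff' (hx.ne_zero s hs)]
      intro a ha
      exact hx.notMem_span t ht s hs hst.symm (mem_span_singleton.2 ⟨a, ha⟩)
    have := finrank_span_eq_card hli
    rwa [Matrix.range_cons_cons_empty, Fintype.card_fin] at this
  have hW : finrank 𝕜 Kᗮ = 2 := by
    have := finrank_add_finrank_orthogonal K
    omega
  have hsK : x s ∈ K := subset_span (by simp)
  have htK : x t ∈ K := subset_span (by simp)
  refine hx.exists_insert ⟨s, hs⟩ hv Kᗮ ?_ ?_ ?_ ?_ ?_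
  · intro z hz hzv
    rw [orthogonal_le_orthogonal_iff, span_singleton_le_iff_mem]
    rcases (hG.eq_of_two_neighbors hS hv hs ht hz hst hsv htv hv hzv (Reachable.refl v)).2 with
      rfl | rfl
    · exact hsK
    · exact htK
  · intro z hz hzv
    rw [orthogonal_le_orthogonal_iff, span_singleton_le_iff_mem]
    exact hx.notMem_span_pair s hs t ht z hz hst (by rintro rfl; exact hzv hsv)
      (by rintro rfl; exact hzv htv) hls
  · intro z hz
    exact not_le_of_finrank_lt (by rw [finrank_span_singleton (hx.ne_zero z hz)]; omega)
  -- By dimension, `Kᗮ` would be the span of `x a` and `x b`, making `a` and `b` both adjacent to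
  -- `s` and `t`. Then the path `a`, `t`, `b` is a connected set, `s` outside it has the two
  -- neighbours `a` and `b`, and `s`, `v`, `t` is a forbidden third connection.
  · intro a ha b hb hab _ hle
    have heq : Kᗮ = span 𝕜 {x a, x b} :=
      eq_of_le_of_finrank_le hle (by rw [hW]; exact finrank_span_pair_le _ _)
    have hadj : ∀ c ∈ S, x c ∈ Kᗮ → G.Adj c s ∧ G.Adj c t := by
      intro c hc hcK
      have h0 : ∀ r ∈ S, x r ∈ K → G.Adj c r := by
        intro r hr hrK
        have hin : inner 𝕜 (x c) (x r) = 0 := inner_left_of_mem_orthogonal hrK hcK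
        refine (hx.inner_eq_zero_iff c hc r hr ?_).1 hin
        rintro rfl
        exact hx.ne_zero c hc (inner_self_eq_zero.1 hin)
      exact ⟨h0 s hs hsK, h0 t ht htK⟩
    obtain ⟨has, hat⟩ := hadj a ha (heq ▸ subset_span (by simp))
    obtain ⟨hbs, hbt⟩ := hadj b hb (heq ▸ subset_span (by simp))
    have hT : G.ConnectedOn {b, a, t} := by
      have h0 : G.ConnectedOn {t} := by
        rintro _ rfl _ rfl
        exact Reachable.refl _
      exact (h0.insert rfl hat.symm).insert (by simp) hbt.symm
    have hsT : s ∉ ({b, a, t} : Set V) := by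
      simp [hbs.ne', has.ne', hst]
    have hvT : v ∉ ({b, a, t} : Set V) := by
      rintro (rfl | rfl | rfl)
      exacts [hv hb, hv ha, hv ht]
    refine hsv.ne' (hG.eq_of_two_neighbors (w := v) (s₃ := t) hT hsT (s₁ := a) (s₂ := b) (by simp)
      (by simp) (by simp) hab has hbs hvT htv (Adj.reachable ⟨hsv, hsT, hvT⟩)).1
  -- This case is vacuous: the component of `v` outside `S` meets `S` only through edges at `v`, so
  -- `v` is linked to nothing in `S` once it is added.
  · rintro z hz b hb hzb ⟨p, q, hp, hq, hvp, hbq, hpq⟩ -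
    have hsub : S ⊆ insert v S := Set.subset_insert v S
    have hadj : (G.within Sᶜ).Adj v p := ⟨hvp, hv, fun h => hp (hsub h)⟩
    have := (hG.eq_of_two_neighbors hS hv hs ht hb hst hsv htv (fun h => hq (hsub h)) hbq
      (hadj.reachable.trans (hpq.mono (G.within_mono (Set.compl_subset_compl.2 hsub))))).1
    exact hq (by simp [this])

/-- The complement of a cactus graph has an orthogonal representation in dimension `4`, and in
dimension `3` if the graph is a tree. -/
theorem IsCactus.exists_isComplRep [Finite V] [FiniteDimensional 𝕜 E] (hG : G.IsCactus)
    (hdim : finrank 𝕜 E = 4 ∨ finrank 𝕜 E = 3 ∧ G.IsAcyclic) :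
    ∃ x : V → E, IsComplRep 𝕜 G Set.univ x := by
  classical
  obtain ⟨r⟩ := hG.1.nonempty
  have : Nontrivial E := nontrivial_of_finrank_pos (R := 𝕜) (by omega)
  obtain ⟨e, he⟩ := exists_ne (0 : E)
  let P : Set (Set V) := {S | r ∈ S ∧ G.ConnectedOn S ∧ ∃ x : V → E, IsComplRep 𝕜 G S x}
  have hr : {r} ∈ P := by
    refine ⟨rfl, ?_, fun _ => e, ?_, ?_, ?_, ?_⟩
    · rintro _ rfl _ rfl
      exact Reachable.refl _
    · exact fun _ _ => he
    · rintro _ rfl _ rfl h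
      exact absurd rfl h
    · rintro _ rfl _ rfl h
      exact absurd rfl h
    · rintro _ rfl _ rfl _ _ h
      exact absurd rfl h
  -- A maximal representable connected set must be everything, since otherwise an edge leaves it and
  -- the representation extends to its far end.
  obtain ⟨S, hS⟩ := (Set.toFinite P).exists_maximal ⟨_, hr⟩
  obtain ⟨hrS, hconn, x, hx⟩ := hS.prop
  by_cases huniv : S = Set.univ
  · exact ⟨x, huniv ▸ hx⟩
  exfalso
  obtain ⟨w, hw⟩ := (Set.ne_univ_iff_exists_notMem S).1 huniv
  obtain ⟨p⟩ := hG.1.preconnected r w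
  obtain ⟨d, -, hs, hv⟩ := p.exists_boundary_dart S hrS hw
  obtain ⟨⟨s, v⟩, hsv⟩ := d
  simp only at hs hv hsv
  have hconn' : G.ConnectedOn (insert v S) := hconn.insert hs hsv
  have hext : ∃ y : E, IsComplRep 𝕜 G (insert v S) (Function.update x v y) := by
    by_cases huniq : ∀ z ∈ S, G.Adj z v → z = s
    · refine hx.exists_insert_of_one hs hv hsv huniq (by omega) fun h3 a b ha hb hab => ?_
      obtain ⟨-, hac⟩ := hdim.resolve_left (by omega)
      exact hac.not_linked hconn' ha hb hab
    · push Not at huniq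
      obtain ⟨t, ht, htv, hts⟩ := huniq
      rcases hdim with h4 | ⟨-, hac⟩
      · exact hx.exists_insert_of_two hG hconn hs ht hts.symm hv hsv htv h4
      · exact (hac.not_linked hconn hs ht hts.symm
          ⟨v, v, hv, hv, hsv, htv, Reachable.refl v⟩).elim
  obtain ⟨y, hy⟩ := hext
  have hmem : insert v S ∈ P := ⟨by simp [hrS], hconn', _, hy⟩
  exact hv (hS.le_of_ge hmem (Set.subset_insert v S) (Set.mem_insert v S))

/-- An orthogonal representation bounds the minimum semidefinite rank of the complement by the
dimension. -/
theorem IsComplRep.msr_compl_le {V : Type*} [Fintype V] {G : SimpleGraph V} {d : ℕ}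
    {x : V → EuclideanSpace 𝕜 (Fin d)} (hx : IsComplRep 𝕜 G Set.univ x) : Gᶜ.msr 𝕜 ≤ d := by
  let B : Matrix (Fin d) V 𝕜 := Matrix.of fun k v => x v k
  have hB : ∀ i j, (B.conjTranspose * B) i j = inner 𝕜 (x i) (x j) := by
    intro i j
    simp [B, Matrix.mul_apply, PiLp.inner_apply, mul_comm]
  have hmem : B.conjTranspose * B ∈ Gᶜ.psdMatrices 𝕜 := by
    refine ⟨Matrix.posSemidef_conjTranspose_mul_self B, fun i j hij => ?_⟩
    rw [hB, compl_adj, ne_eq, hx.inner_eq_zero_iff i trivial j trivial hij]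
    simp [hij]
  calc Gᶜ.msr 𝕜 ≤ (B.conjTranspose * B).rank := Nat.sInf_le ⟨_, hmem, rfl⟩
    _ ≤ B.rank := Matrix.rank_mul_le_right _ _
    _ ≤ d := by simpa using B.rank_le_card_height

end Representation

end SimpleGraph

theorem theorem4p7 (𝕜 : Type*) [RCLike 𝕜] {V : Type*} [Fintype V] (G : SimpleGraph V)
    (hG : G.IsCactus) :
    G.msr 𝕜 + Gᶜ.msr 𝕜 ≤ Fintype.card V + 2 := by
  classical
  have := hG.1.nonempty
  -- A cycle costs one more dimension for the complement and saves one in the rank for `G`.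
  by_cases hac : G.IsAcyclic
  · obtain ⟨x, hx⟩ := hG.exists_isComplRep (𝕜 := 𝕜) (E := EuclideanSpace 𝕜 (Fin 3))
      (Or.inr ⟨by simp, hac⟩)
    have h1 := hx.msr_compl_le
    have h2 := SimpleGraph.msr_add_one_le_card 𝕜 G
    omega
  · obtain ⟨x, hx⟩ := hG.exists_isComplRep (𝕜 := 𝕜) (E := EuclideanSpace 𝕜 (Fin 4))
      (Or.inl (by simp))
    have h1 := hx.msr_compl_le
    have h2 := hG.msr_add_two_le_card 𝕜 hac
    omega
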